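/- Let $G$ be a finite group and let $T$ be a $G$-Tambara functor, i.e. a product-preserving functor from the category of bispans of finite $G$-sets to sets whose values are commutative rings. It has norms $\mathrm{nm}_f$, transfers $\mathrm{tr}_f$ and restrictions $\mathrm{res}_f$ for each map $f$ of finite $G$-sets; for subgroups $H \leq K$ write $\mathrm{tr}_H^K, \mathrm{nm}_H^K : T(G/H) \to T(G/K)$ and $\mathrm{res}^K_H : T(G/K) \to T(G/H)$ for the operations along the quotient map $G/H \to G/K$, and for $g \in G$ write $\mathrm{conj}_g : T(G/H) \to T(G/gHg^{-1})$ for the isomorphism induced by $xH \mapsto xg^{-1}(gHg^{-1})$. For $x \in T(G/H)$ let $T \to T[1/x]$ be the localization, i.e. the initial morphism of Tambara functors out of $T$ that sends $x$ to a unit; $x$ is called a kilpotent if $T[1/x] = 0$, and $\mathrm{kil}(T)(G/H) \subseteq T(G/H)$ denotes the set of kilpotents. A Tambara ideal $I$ of $T$ is a family of ideals $I(G/H) \subseteq T(G/H)$, $H \leq G$, closed under the maps $\mathrm{res}^K_H$, $\mathrm{tr}^K_H$, $\mathrm{nm}^K_H$ and $\mathrm{conj}_g$. Suppose that the Weyl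 action of $G \cong \mathrm{Aut}(G/e)$ on the ring $T(G/e)$ is trivial. Then $\mathrm{kil}(T)$ is a Tambara ideal of $T$, and for every subgroup $H \leq G$ $$\mathrm{kil}(T)(G/H) = \{\, x \in T(G/H) : \mathrm{res}^H_e(x) \text{ is nilpotent in } T(G/e) \,\}.$$ -/

import Mathlib

universe u v w

/-- A finite `G`-set. -/
structure FinGSet (G : Type u) [Group G] : Type (u + 1) where
  carrier : Type u
  [action : MulAction G carrier]
  [finite : Finite carrier]

namespace FinGSet

variable {G : Type u} [Group G]

instance : CoeSort (FinGSet G) (Type u) := ⟨FinGSet.carrier⟩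

attribute [instance] FinGSet.action FinGSet.finite

/-- Morphisms of finite `G`-sets are the `G`-equivariant maps. -/
abbrev Hom (X Y : FinGSet G) : Type u := X →[G] Y

/-- The empty `G`-set. -/
def empty (G : Type u) [Group G] : FinGSet G where
  carrier := PEmpty.{u + 1}
  action := { smul := fun _ a => a, one_smul := fun _ => rfl, mul_smul := fun _ _ _ => rfl }

/-- The unique map out of the empty `G`-set. -/
def fromEmpty (X : FinGSet G) : Hom (empty G) X where
  toFun := fun a => PEmpty.elim a
  map_smul' := fun _ a => PEmpty.elim a

/-- The disjoint union of two finite `G`-sets. -/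
def coprod (X Y : FinGSet G) : FinGSet G where
  carrier := X ⊕ Y

def inl (X Y : FinGSet G) : Hom X (coprod X Y) where
  toFun := Sum.inl
  map_smul' := fun _ _ => rfl

def inr (X Y : FinGSet G) : Hom Y (coprod X Y) where
  toFun := Sum.inr
  map_smul' := fun _ _ => rfl

/-- The fold map `X ⨿ X → X`. -/
def fold (X : FinGSet G) : Hom (coprod X X) X where
  toFun := Sum.elim id id
  map_smul' := by rintro m (a | a) <;> rfl

/-- The square `f ∘ p = g ∘ q` exhibits `P` as the pullback of `f : X → Z` and `g : Y → Z`,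
with projections `p : P → X` and `q : P → Y`. -/
def IsPullback {P X Y Z : FinGSet G} (p : Hom P X) (q : Hom P Y) (f : Hom X Z) (g : Hom Y Z) :
    Prop :=
  (∀ a, f (p a) = g (q a)) ∧ ∀ x y, f x = g y → ∃! a, p a = x ∧ q a = y

/-- The diagram
```
      E --f'--> P
  ε ↙ |e        | π
  X   |         |
  g ↘ ↓         ↓
      Y --f---> Z
```
is an exponential diagram: `π : P → Z` is the dependent product of `g : X → Y` along `f : Y → Z`,
the square is a pullback and `ε` is the counit. That `P` is the dependent product
means that the point `b` of the fibre of `P` over `z`, regarded as the map `e ↦ ε e` on the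
elements of `E` over `b`, runs exactly once through the sections of `g` over the fibre `f⁻¹(z)`.
(The actions of `G` correspond, since all the maps are equivariant.) -/
def IsExponential {X Y Z P E : FinGSet G} (g : Hom X Y) (f : Hom Y Z) (π : Hom P Z)
    (f' : Hom E P) (e : Hom E Y) (ε : Hom E X) : Prop :=
  IsPullback e f' f π ∧ (∀ a, g (ε a) = e a) ∧
    ∀ (z : Z) (s : {y : Y // f y = z} → X), (∀ y, g (s y) = y) →
      ∃! b : P, π b = z ∧ ∀ (a : E) (y : {y : Y // f y = z}), f' a = b → e a = y → ε a = s y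

section Orbits

variable [Finite G]

/-- The orbit `G/H`. -/
def orbit (H : Subgroup G) : FinGSet G where
  carrier := G ⧸ H

/-- The canonical quotient `G/H → G/K`, `xH ↦ xK`, for `H ≤ K`. -/
def quot {H K : Subgroup G} (h : H ≤ K) : Hom (orbit H) (orbit K) where
  toFun := Quotient.map' id (fun _ _ hab =>
    QuotientGroup.leftRel_apply.2 (h (QuotientGroup.leftRel_apply.1 hab)))
  map_smul' := by
    rintro m ⟨a⟩
    rfl

/-- The conjugate subgroup `gHg⁻¹`. -/
def conjSubgroup (g : G) (H : Subgroup G) : Subgroup G := H.map (MulAut.conj g).toMonoidHom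

/-- The canonical isomorphism `G/H → G/gHg⁻¹`, `xH ↦ xg⁻¹(gHg⁻¹)`. -/
def conjMap (g : G) (H : Subgroup G) : Hom (orbit H) (orbit (conjSubgroup g H)) where
  toFun := Quotient.map' (fun x => x * g⁻¹) (fun a b hab => by
    rw [QuotientGroup.leftRel_apply] at hab ⊢
    refine ⟨a⁻¹ * b, hab, ?_⟩
    simp [mul_assoc])
  map_smul' := by
    rintro m ⟨a⟩
    exact congrArg (QuotientGroup.mk (s := conjSubgroup g H)) (mul_assoc m a g⁻¹)

/-- The automorphism `x ↦ xg⁻¹` of `G/e`; these are all the automorphisms of the `G`-set `G/e`. -/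
def weylMap (g : G) : Hom (orbit (⊥ : Subgroup G)) (orbit (⊥ : Subgroup G)) where
  toFun := Quotient.map' (fun x => x * g⁻¹) (fun a b hab => by
    rw [QuotientGroup.leftRel_apply, Subgroup.mem_bot] at hab ⊢
    rw [inv_mul_eq_one] at hab
    simp [hab])
  map_smul' := by
    rintro m ⟨a⟩
    exact congrArg (QuotientGroup.mk (s := (⊥ : Subgroup G))) (mul_assoc m a g⁻¹)

end Orbits

end FinGSet

open FinGSet in
/-- A `G`-Tambara functor: a product-preserving functor on the category of bispans of finite
`G`-sets, all of whose values are commutative rings. The category of bispans is generated by the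
morphisms `T_f`, `N_f`, `R_f` subject to functoriality, base change of `T` and `N` along pullback
squares, and the distributive law for exponential diagrams, so a functor on it amounts to the maps
`tr`, `nm`, `res` below with these relations. The last four fields say that the ring structure
on each value is the one induced by the semiring object structure on each finite `G`-set. -/
structure TambaraFunctor (G : Type u) [Group G] where
  obj : FinGSet G → Type v
  [ring : ∀ X, CommRing (obj X)]
  /-- The transfer along `f`. -/
  tr : ∀ {X Y : FinGSet G}, Hom X Y → obj X → obj Y
  /-- The norm along `f`. -/
  nm : ∀ {X Y : FinGSet G}, Hom X Y → obj X → obj Y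
  /-- The restriction along `f`. -/
  res : ∀ {X Y : FinGSet G}, Hom X Y → obj Y → obj X
  tr_id : ∀ {X : FinGSet G} (a : obj X), tr (MulActionHom.id G) a = a
  nm_id : ∀ {X : FinGSet G} (a : obj X), nm (MulActionHom.id G) a = a
  res_id : ∀ {X : FinGSet G} (a : obj X), res (MulActionHom.id G) a = a
  tr_comp : ∀ {X Y Z : FinGSet G} (f : Hom Y Z) (g : Hom X Y) (a : obj X),
    tr (f.comp g) a = tr f (tr g a)
  nm_comp : ∀ {X Y Z : FinGSet G} (f : Hom Y Z) (g : Hom X Y) (a : obj X),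
    nm (f.comp g) a = nm f (nm g a)
  res_comp : ∀ {X Y Z : FinGSet G} (f : Hom Y Z) (g : Hom X Y) (a : obj Z),
    res (f.comp g) a = res g (res f a)
  res_tr : ∀ {P X Y Z : FinGSet G} (p : Hom P X) (q : Hom P Y) (f : Hom X Z) (g : Hom Y Z),
    IsPullback p q f g → ∀ a : obj Y, res f (tr g a) = tr p (res q a)
  res_nm : ∀ {P X Y Z : FinGSet G} (p : Hom P X) (q : Hom P Y) (f : Hom X Z) (g : Hom Y Z),
    IsPullback p q f g → ∀ a : obj Y, res f (nm g a) = nm p (res q a)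
  nm_tr : ∀ {X Y Z P E : FinGSet G} (g : Hom X Y) (f : Hom Y Z) (π : Hom P Z) (f' : Hom E P)
    (e : Hom E Y) (ε : Hom E X), IsExponential g f π f' e ε →
      ∀ a : obj X, nm f (tr g a) = tr π (nm f' (res ε a))
  /-- The value on the empty `G`-set is a one-point set. -/
  obj_empty : Subsingleton (obj (FinGSet.empty G))
  /-- The value on a disjoint union is the product of the values. -/
  obj_coprod : ∀ X Y : FinGSet G,
    Function.Bijective fun c : obj (coprod X Y) => (res (inl X Y) c, res (inr X Y) c)
  tr_fromEmpty : ∀ (X : FinGSet G) (a : obj (FinGSet.empty G)), tr (fromEmpty X) a = 0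
  nm_fromEmpty : ∀ (X : FinGSet G) (a : obj (FinGSet.empty G)), nm (fromEmpty X) a = 1
  tr_fold : ∀ (X : FinGSet G) (c : obj (coprod X X)),
    tr (fold X) c = res (inl X X) c + res (inr X X) c
  nm_fold : ∀ (X : FinGSet G) (c : obj (coprod X X)),
    nm (fold X) c = res (inl X X) c * res (inr X X) c

namespace TambaraFunctor

open FinGSet

variable {G : Type u} [Group G]

attribute [instance] TambaraFunctor.ring

/-- A morphism of Tambara functors: a natural transformation, i.e. a family of maps commuting with
transfers, norms and restrictions. -/
@[ext]
structure Mor (T : TambaraFunctor.{u, v} G) (S : TambaraFunctor.{u, w} G) where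
  app : ∀ X : FinGSet G, T.obj X → S.obj X
  app_tr : ∀ {X Y : FinGSet G} (f : Hom X Y) (a : T.obj X), app Y (T.tr f a) = S.tr f (app X a)
  app_nm : ∀ {X Y : FinGSet G} (f : Hom X Y) (a : T.obj X), app Y (T.nm f a) = S.nm f (app X a)
  app_res : ∀ {X Y : FinGSet G} (f : Hom X Y) (a : T.obj Y), app X (T.res f a) = S.res f (app Y a)

/-- `T = 0`: every value of `T` is the zero ring. -/
def IsZero (T : TambaraFunctor.{u, v} G) : Prop := ∀ X : FinGSet G, Subsingleton (T.obj X)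

/-! ### The localization `T[1/x]`

It is built from formal expressions in the elements of `T` and an inverse of `x`, modulo the
relations that hold in every Tambara functor under `T` in which `x` is a unit. The universal
property is `localization_universal`. -/

section Localization

/-- Formal expressions in the elements of `T` and an inverse of `x`. -/
inductive Pre (T : TambaraFunctor.{u, v} G) {A : FinGSet G} (x : T.obj A) :
    FinGSet G → Type (max (u + 1) v)
  | of {X : FinGSet G} (a : T.obj X) : Pre T x X
  | inv : Pre T x A
  | zero {X : FinGSet G} : Pre T x X
  | one {X : FinGSet G} : Pre T x X
  | add {X : FinGSet G} (a b : Pre T x X) : Pre T x X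
  | mul {X : FinGSet G} (a b : Pre T x X) : Pre T x X
  | neg {X : FinGSet G} (a : Pre T x X) : Pre T x X
  | pair {X Y : FinGSet G} (a : Pre T x X) (b : Pre T x Y) : Pre T x (coprod X Y)
  | tr {X Y : FinGSet G} (f : Hom X Y) (a : Pre T x X) : Pre T x Y
  | nm {X Y : FinGSet G} (f : Hom X Y) (a : Pre T x X) : Pre T x Y
  | res {X Y : FinGSet G} (f : Hom X Y) (a : Pre T x Y) : Pre T x X

/-- The congruence on formal expressions generated by: `of` is a morphism, `inv` is inverse to `x`,
and the laws of a Tambara functor. -/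
inductive Rel (T : TambaraFunctor.{u, v} G) {A : FinGSet G} (x : T.obj A) :
    ∀ {X : FinGSet G}, Pre T x X → Pre T x X → Prop
  | refl {X} (a : Pre T x X) : Rel T x a a
  | symm {X} {a b : Pre T x X} : Rel T x a b → Rel T x b a
  | trans {X} {a b c : Pre T x X} : Rel T x a b → Rel T x b c → Rel T x a c
  | add_congr {X} {a a' b b' : Pre T x X} :
      Rel T x a a' → Rel T x b b' → Rel T x (.add a b) (.add a' b')
  | mul_congr {X} {a a' b b' : Pre T x X} :
      Rel T x a a' → Rel T x b b' → Rel T x (.mul a b) (.mul a' b')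
  | neg_congr {X} {a a' : Pre T x X} : Rel T x a a' → Rel T x (.neg a) (.neg a')
  | tr_congr {X Y} (f : Hom X Y) {a a' : Pre T x X} : Rel T x a a' → Rel T x (.tr f a) (.tr f a')
  | nm_congr {X Y} (f : Hom X Y) {a a' : Pre T x X} : Rel T x a a' → Rel T x (.nm f a) (.nm f a')
  | res_congr {X Y} (f : Hom X Y) {a a' : Pre T x Y} :
      Rel T x a a' → Rel T x (.res f a) (.res f a')
  | of_tr {X Y} (f : Hom X Y) (a : T.obj X) : Rel T x (.of (T.tr f a)) (.tr f (.of a))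
  | of_nm {X Y} (f : Hom X Y) (a : T.obj X) : Rel T x (.of (T.nm f a)) (.nm f (.of a))
  | of_res {X Y} (f : Hom X Y) (a : T.obj Y) : Rel T x (.of (T.res f a)) (.res f (.of a))
  | mul_inv : Rel T x (.mul (.of x) .inv) .one
  | add_assoc {X} (a b c : Pre T x X) : Rel T x (.add (.add a b) c) (.add a (.add b c))
  | add_comm {X} (a b : Pre T x X) : Rel T x (.add a b) (.add b a)
  | zero_add {X} (a : Pre T x X) : Rel T x (.add .zero a) a
  | neg_add {X} (a : Pre T x X) : Rel T x (.add (.neg a) a) .zero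
  | mul_assoc {X} (a b c : Pre T x X) : Rel T x (.mul (.mul a b) c) (.mul a (.mul b c))
  | mul_comm {X} (a b : Pre T x X) : Rel T x (.mul a b) (.mul b a)
  | one_mul {X} (a : Pre T x X) : Rel T x (.mul .one a) a
  | mul_add {X} (a b c : Pre T x X) :
      Rel T x (.mul a (.add b c)) (.add (.mul a b) (.mul a c))
  | tr_id {X} (a : Pre T x X) : Rel T x (.tr (MulActionHom.id G) a) a
  | nm_id {X} (a : Pre T x X) : Rel T x (.nm (MulActionHom.id G) a) a
  | res_id {X} (a : Pre T x X) : Rel T x (.res (MulActionHom.id G) a) a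
  | tr_comp {X Y Z} (f : Hom Y Z) (g : Hom X Y) (a : Pre T x X) :
      Rel T x (.tr (f.comp g) a) (.tr f (.tr g a))
  | nm_comp {X Y Z} (f : Hom Y Z) (g : Hom X Y) (a : Pre T x X) :
      Rel T x (.nm (f.comp g) a) (.nm f (.nm g a))
  | res_comp {X Y Z} (f : Hom Y Z) (g : Hom X Y) (a : Pre T x Z) :
      Rel T x (.res (f.comp g) a) (.res g (.res f a))
  | res_tr {P X Y Z} (p : Hom P X) (q : Hom P Y) (f : Hom X Z) (g : Hom Y Z) :
      IsPullback p q f g → ∀ a : Pre T x Y, Rel T x (.res f (.tr g a)) (.tr p (.res q a))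
  | res_nm {P X Y Z} (p : Hom P X) (q : Hom P Y) (f : Hom X Z) (g : Hom Y Z) :
      IsPullback p q f g → ∀ a : Pre T x Y, Rel T x (.res f (.nm g a)) (.nm p (.res q a))
  | nm_tr {X Y Z P E} (g : Hom X Y) (f : Hom Y Z) (π : Hom P Z) (f' : Hom E P)
      (e : Hom E Y) (ε : Hom E X) : IsExponential g f π f' e ε →
      ∀ a : Pre T x X, Rel T x (.nm f (.tr g a)) (.tr π (.nm f' (.res ε a)))
  | obj_empty (a b : Pre T x (FinGSet.empty G)) : Rel T x a b
  | res_inl {X Y} (a : Pre T x X) (b : Pre T x Y) : Rel T x (.res (inl X Y) (.pair a b)) a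
  | res_inr {X Y} (a : Pre T x X) (b : Pre T x Y) : Rel T x (.res (inr X Y) (.pair a b)) b
  | coprod_ext {X Y} (c d : Pre T x (coprod X Y)) :
      Rel T x (.res (inl X Y) c) (.res (inl X Y) d) →
      Rel T x (.res (inr X Y) c) (.res (inr X Y) d) → Rel T x c d
  | tr_fromEmpty (X) (a : Pre T x (FinGSet.empty G)) : Rel T x (.tr (fromEmpty X) a) .zero
  | nm_fromEmpty (X) (a : Pre T x (FinGSet.empty G)) : Rel T x (.nm (fromEmpty X) a) .one
  | tr_fold (X) (c : Pre T x (coprod X X)) :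
      Rel T x (.tr (fold X) c) (.add (.res (inl X X) c) (.res (inr X X) c))
  | nm_fold (X) (c : Pre T x (coprod X X)) :
      Rel T x (.nm (fold X) c) (.mul (.res (inl X X) c) (.res (inr X X) c))

variable (T : TambaraFunctor.{u, v} G) {A : FinGSet G} (x : T.obj A)

instance preSetoid (X : FinGSet G) : Setoid (Pre T x X) where
  r := Rel T x
  iseqv := ⟨Rel.refl, Rel.symm, Rel.trans⟩

/-- The values of `T[1/x]`. -/
def LocObj (X : FinGSet G) : Type (max (u + 1) v) := Quotient (preSetoid T x X)

/-- The class in `T[1/x]` of a formal expression. -/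
def LocObj.mk {X : FinGSet G} (a : Pre T x X) : LocObj T x X := Quotient.mk _ a

instance locZero (X : FinGSet G) : Zero (LocObj T x X) := ⟨LocObj.mk T x .zero⟩

instance locOne (X : FinGSet G) : One (LocObj T x X) := ⟨LocObj.mk T x .one⟩

instance locAdd (X : FinGSet G) : Add (LocObj T x X) :=
  ⟨Quotient.map₂ .add fun _ _ h _ _ h' => Rel.add_congr h h'⟩

instance locMul (X : FinGSet G) : Mul (LocObj T x X) :=
  ⟨Quotient.map₂ .mul fun _ _ h _ _ h' => Rel.mul_congr h h'⟩

instance locNeg (X : FinGSet G) : Neg (LocObj T x X) :=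
  ⟨Quotient.map .neg fun _ _ h => Rel.neg_congr h⟩

instance locRing (X : FinGSet G) : CommRing (LocObj T x X) where
  nsmul := nsmulRec
  zsmul := zsmulRec
  add_assoc := by rintro ⟨a⟩ ⟨b⟩ ⟨c⟩; exact Quotient.sound (Rel.add_assoc a b c)
  add_comm := by rintro ⟨a⟩ ⟨b⟩; exact Quotient.sound (Rel.add_comm a b)
  zero_add := by rintro ⟨a⟩; exact Quotient.sound (Rel.zero_add a)
  add_zero := by rintro ⟨a⟩; exact Quotient.sound ((Rel.add_comm _ _).trans (Rel.zero_add a))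
  neg_add_cancel := by rintro ⟨a⟩; exact Quotient.sound (Rel.neg_add a)
  mul_assoc := by rintro ⟨a⟩ ⟨b⟩ ⟨c⟩; exact Quotient.sound (Rel.mul_assoc a b c)
  mul_comm := by rintro ⟨a⟩ ⟨b⟩; exact Quotient.sound (Rel.mul_comm a b)
  one_mul := by rintro ⟨a⟩; exact Quotient.sound (Rel.one_mul a)
  mul_one := by rintro ⟨a⟩; exact Quotient.sound ((Rel.mul_comm _ _).trans (Rel.one_mul a))
  left_distrib := by rintro ⟨a⟩ ⟨b⟩ ⟨c⟩; exact Quotient.sound (Rel.mul_add a b c)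
  right_distrib := by
    rintro ⟨a⟩ ⟨b⟩ ⟨c⟩
    exact Quotient.sound ((Rel.mul_comm _ _).trans ((Rel.mul_add c a b).trans
      (Rel.add_congr (Rel.mul_comm _ _) (Rel.mul_comm _ _))))
  zero_mul := by
    rintro ⟨a⟩
    apply Quotient.sound
    have h : Rel T x (.add (.mul .zero a) (.mul .zero a)) (.mul .zero a) :=
      (Rel.add_congr (Rel.mul_comm _ _) (Rel.mul_comm _ _)).trans ((Rel.mul_add a .zero .zero).symm.trans
        ((Rel.mul_congr (Rel.refl a) (Rel.zero_add .zero)).trans (Rel.mul_comm _ _)))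
    exact (Rel.zero_add _).symm.trans ((Rel.add_congr (Rel.neg_add (.mul .zero a)).symm
      (Rel.refl _)).trans ((Rel.add_assoc _ _ _).trans ((Rel.add_congr (Rel.refl _) h).trans
        (Rel.neg_add _))))
  mul_zero := by
    rintro ⟨a⟩
    apply Quotient.sound
    have h : Rel T x (.add (.mul a .zero) (.mul a .zero)) (.mul a .zero) :=
      (Rel.mul_add a .zero .zero).symm.trans (Rel.mul_congr (Rel.refl a) (Rel.zero_add .zero))
    exact (Rel.zero_add _).symm.trans ((Rel.add_congr (Rel.neg_add (.mul a .zero)).symm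
      (Rel.refl _)).trans ((Rel.add_assoc _ _ _).trans ((Rel.add_congr (Rel.refl _) h).trans
        (Rel.neg_add _))))

/-- The localization `T[1/x]`. -/
def localization : TambaraFunctor.{u, max (u + 1) v} G where
  obj := LocObj T x
  tr f := Quotient.map (.tr f) fun _ _ h => Rel.tr_congr f h
  nm f := Quotient.map (.nm f) fun _ _ h => Rel.nm_congr f h
  res f := Quotient.map (.res f) fun _ _ h => Rel.res_congr f h
  tr_id := by rintro X ⟨a⟩; exact Quotient.sound (Rel.tr_id a)
  nm_id := by rintro X ⟨a⟩; exact Quotient.sound (Rel.nm_id a)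
  res_id := by rintro X ⟨a⟩; exact Quotient.sound (Rel.res_id a)
  tr_comp := by rintro X Y Z f g ⟨a⟩; exact Quotient.sound (Rel.tr_comp f g a)
  nm_comp := by rintro X Y Z f g ⟨a⟩; exact Quotient.sound (Rel.nm_comp f g a)
  res_comp := by rintro X Y Z f g ⟨a⟩; exact Quotient.sound (Rel.res_comp f g a)
  res_tr := by rintro P X Y Z p q f g h ⟨a⟩; exact Quotient.sound (Rel.res_tr p q f g h a)
  res_nm := by rintro P X Y Z p q f g h ⟨a⟩; exact Quotient.sound (Rel.res_nm p q f g h a)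
  nm_tr := by
    rintro X Y Z P E g f π f' e ε h ⟨a⟩
    exact Quotient.sound (Rel.nm_tr g f π f' e ε h a)
  obj_empty := ⟨by rintro ⟨a⟩ ⟨b⟩; exact Quotient.sound (Rel.obj_empty a b)⟩
  obj_coprod X Y := by
    constructor
    · rintro ⟨c⟩ ⟨d⟩ h
      exact Quotient.sound (Rel.coprod_ext c d (Quotient.exact (Prod.ext_iff.1 h).1)
        (Quotient.exact (Prod.ext_iff.1 h).2))
    · rintro ⟨⟨a⟩, ⟨b⟩⟩
      exact ⟨LocObj.mk T x (.pair a b),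
        Prod.ext (Quotient.sound (Rel.res_inl a b)) (Quotient.sound (Rel.res_inr a b))⟩
  tr_fromEmpty := by rintro X ⟨a⟩; exact Quotient.sound (Rel.tr_fromEmpty X a)
  nm_fromEmpty := by rintro X ⟨a⟩; exact Quotient.sound (Rel.nm_fromEmpty X a)
  tr_fold := by rintro X ⟨c⟩; exact Quotient.sound (Rel.tr_fold X c)
  nm_fold := by rintro X ⟨c⟩; exact Quotient.sound (Rel.nm_fold X c)

/-- The canonical map `T → T[1/x]`. -/
def toLocalization : Mor T (localization T x) where
  app _ a := LocObj.mk T x (.of a)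
  app_tr f a := Quotient.sound (Rel.of_tr f a)
  app_nm f a := Quotient.sound (Rel.of_nm f a)
  app_res f a := Quotient.sound (Rel.of_res f a)

theorem toLocalization_isUnit : IsUnit ((toLocalization T x).app A x) :=
  IsUnit.of_mul_eq_one (M := LocObj T x A) (LocObj.mk T x .inv) (Quotient.sound Rel.mul_inv)

variable {T x}

/-- The value of a formal expression in a Tambara functor under `T` where `x` has the inverse
`i`. -/
noncomputable def Pre.eval {S : TambaraFunctor.{u, w} G} (ψ : Mor T S) (i : S.obj A) :
    ∀ {X : FinGSet G}, Pre T x X → S.obj X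
  | _, .of a => ψ.app _ a
  | _, .inv => i
  | _, .zero => 0
  | _, .one => 1
  | _, .add a b => a.eval ψ i + b.eval ψ i
  | _, .mul a b => a.eval ψ i * b.eval ψ i
  | _, .neg a => -a.eval ψ i
  | _, .pair a b => ((S.obj_coprod _ _).2 (a.eval ψ i, b.eval ψ i)).choose
  | _, .tr f a => S.tr f (a.eval ψ i)
  | _, .nm f a => S.nm f (a.eval ψ i)
  | _, .res f a => S.res f (a.eval ψ i)

theorem Rel.eval_eq {S : TambaraFunctor.{u, w} G} (ψ : Mor T S) (i : S.obj A)
    (hi : ψ.app A x * i = 1) {X : FinGSet G} {a b : Pre T x X} (h : Rel T x a b) :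
    a.eval ψ i = b.eval ψ i := by
  induction h with
  | refl a => rfl
  | symm _ ih => exact ih.symm
  | trans _ _ ih ih' => exact ih.trans ih'
  | add_congr _ _ ih ih' => simp only [Pre.eval, ih, ih']
  | mul_congr _ _ ih ih' => simp only [Pre.eval, ih, ih']
  | neg_congr _ ih => simp only [Pre.eval, ih]
  | tr_congr f _ ih => simp only [Pre.eval, ih]
  | nm_congr f _ ih => simp only [Pre.eval, ih]
  | res_congr f _ ih => simp only [Pre.eval, ih]
  | of_tr f a => exact ψ.app_tr f a
  | of_nm f a => exact ψ.app_nm f a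
  | of_res f a => exact ψ.app_res f a
  | mul_inv => exact hi
  | add_assoc a b c => exact _root_.add_assoc _ _ _
  | add_comm a b => exact _root_.add_comm _ _
  | zero_add a => exact _root_.zero_add _
  | neg_add a => exact neg_add_cancel _
  | mul_assoc a b c => exact _root_.mul_assoc _ _ _
  | mul_comm a b => exact _root_.mul_comm _ _
  | one_mul a => exact _root_.one_mul _
  | mul_add a b c => exact _root_.mul_add _ _ _
  | tr_id a => exact S.tr_id _
  | nm_id a => exact S.nm_id _
  | res_id a => exact S.res_id _
  | tr_comp f g a => exact S.tr_comp f g _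
  | nm_comp f g a => exact S.nm_comp f g _
  | res_comp f g a => exact S.res_comp f g _
  | res_tr p q f g h a => exact S.res_tr p q f g h _
  | res_nm p q f g h a => exact S.res_nm p q f g h _
  | nm_tr g f π f' e ε h a => exact S.nm_tr g f π f' e ε h _
  | obj_empty a b => exact S.obj_empty.elim _ _
  | res_inl a b =>
    exact congrArg Prod.fst ((S.obj_coprod _ _).2 (a.eval ψ i, b.eval ψ i)).choose_spec
  | res_inr a b =>
    exact congrArg Prod.snd ((S.obj_coprod _ _).2 (a.eval ψ i, b.eval ψ i)).choose_spec
  | coprod_ext c d _ _ ih ih' => exact (S.obj_coprod _ _).1 (Prod.ext ih ih')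
  | tr_fromEmpty X a => exact S.tr_fromEmpty X _
  | nm_fromEmpty X a => exact S.nm_fromEmpty X _
  | tr_fold X c => exact S.tr_fold X _
  | nm_fold X c => exact S.nm_fold X _

/-- The factorization through `T[1/x]` of a morphism that makes `x` invertible. -/
noncomputable def localizationLift {S : TambaraFunctor.{u, w} G} (ψ : Mor T S) (i : S.obj A)
    (hi : ψ.app A x * i = 1) : Mor (localization T x) S where
  app _ := Quotient.lift (Pre.eval ψ i) fun _ _ h => Rel.eval_eq ψ i hi h
  app_tr := by rintro X Y f ⟨a⟩; rfl
  app_nm := by rintro X Y f ⟨a⟩; rfl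
  app_res := by rintro X Y f ⟨a⟩; rfl

theorem Mor.app_zero {S : TambaraFunctor.{u, w} G} (φ : Mor T S) (X : FinGSet G) :
    φ.app X 0 = 0 := by
  rw [← T.tr_fromEmpty X 0, φ.app_tr, S.tr_fromEmpty]

theorem Mor.app_one {S : TambaraFunctor.{u, w} G} (φ : Mor T S) (X : FinGSet G) :
    φ.app X 1 = 1 := by
  rw [← T.nm_fromEmpty X 0, φ.app_nm, S.nm_fromEmpty]

theorem Mor.app_add {S : TambaraFunctor.{u, w} G} (φ : Mor T S) {X : FinGSet G} (a b : T.obj X) :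
    φ.app X (a + b) = φ.app X a + φ.app X b := by
  obtain ⟨c, hc⟩ := (T.obj_coprod X X).2 (a, b)
  obtain ⟨rfl, rfl⟩ := Prod.ext_iff.1 hc
  simp only [← φ.app_res, ← T.tr_fold, φ.app_tr, S.tr_fold]

theorem Mor.app_mul {S : TambaraFunctor.{u, w} G} (φ : Mor T S) {X : FinGSet G} (a b : T.obj X) :
    φ.app X (a * b) = φ.app X a * φ.app X b := by
  obtain ⟨c, hc⟩ := (T.obj_coprod X X).2 (a, b)
  obtain ⟨rfl, rfl⟩ := Prod.ext_iff.1 hc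
  simp only [← φ.app_res, ← T.nm_fold, φ.app_nm, S.nm_fold]

theorem Mor.app_neg {S : TambaraFunctor.{u, w} G} (φ : Mor T S) {X : FinGSet G} (a : T.obj X) :
    φ.app X (-a) = -φ.app X a := by
  rw [eq_neg_iff_add_eq_zero, ← φ.app_add, neg_add_cancel, φ.app_zero]

variable (T x) in
/-- `T → T[1/x]` is initial among the morphisms `T → S` that send `x` to a unit. -/
theorem localization_universal (S : TambaraFunctor.{u, w} G) (ψ : Mor T S)
    (hψ : IsUnit (ψ.app A x)) :
    ∃! χ : Mor (localization T x) S,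
      ∀ (X : FinGSet G) (a : T.obj X), χ.app X ((toLocalization T x).app X a) = ψ.app X a := by
  obtain ⟨i, hi⟩ := hψ.exists_right_inv
  refine ⟨localizationLift ψ i hi, fun _ _ => rfl, fun χ hχ => ?_⟩
  have key : ∀ (X : FinGSet G) (a : Pre T x X), χ.app X (LocObj.mk T x a) = a.eval ψ i := by
    intro X a
    induction a with
    | of a => exact hχ _ a
    | inv =>
      have h : χ.app A ((toLocalization T x).app A x) * χ.app A (LocObj.mk T x .inv) = 1 :=
        (χ.app_mul _ _).symm.trans
          ((congrArg (χ.app A) (Quotient.sound Rel.mul_inv)).trans (χ.app_one A))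
      rw [hχ] at h
      exact hψ.mul_left_cancel (h.trans hi.symm)
    | zero => exact χ.app_zero _
    | one => exact χ.app_one _
    | add a b ha hb => exact (χ.app_add _ _).trans (congrArg₂ (· + ·) ha hb)
    | mul a b ha hb => exact (χ.app_mul _ _).trans (congrArg₂ (· * ·) ha hb)
    | neg a ha => exact (χ.app_neg _).trans (congrArg Neg.neg ha)
    | pair a b ha hb =>
      apply (S.obj_coprod _ _).1
      refine Eq.trans ?_ ((S.obj_coprod _ _).2 (a.eval ψ i, b.eval ψ i)).choose_spec.symm
      refine Prod.ext ?_ ?_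
      · exact (χ.app_res _ _).symm.trans
          ((congrArg _ (Quotient.sound (Rel.res_inl a b))).trans ha)
      · exact (χ.app_res _ _).symm.trans
          ((congrArg _ (Quotient.sound (Rel.res_inr a b))).trans hb)
    | tr f a ha => exact (χ.app_tr f _).trans (congrArg _ ha)
    | nm f a ha => exact (χ.app_nm f _).trans (congrArg _ ha)
    | res f a ha => exact (χ.app_res f _).trans (congrArg _ ha)
  apply Mor.ext
  funext X a
  obtain ⟨a⟩ := a
  exact key X a

end Localization

variable [Finite G] (T : TambaraFunctor.{u, v} G)

/-- The ring `T(G/H)`. -/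
abbrev level (H : Subgroup G) : Type v := T.obj (orbit H)

/-- An element `x` of `T(G/H)` is kilpotent if `T[1/x] = 0`. -/
def IsKilpotent {H : Subgroup G} (x : T.level H) : Prop := (localization T x).IsZero

/-- The kilradical of `T` at level `G/H`: the set of kilpotent elements of `T(G/H)`. -/
def kil (H : Subgroup G) : Set (T.level H) := {x | T.IsKilpotent x}

/-- A Tambara ideal: ideals of the rings `T(G/H)` that are closed under restriction, transfer, norm
and conjugation. -/
structure TambaraIdeal where
  ideal : ∀ H : Subgroup G, Ideal (T.level H)
  res_mem : ∀ {H K : Subgroup G} (h : H ≤ K), ∀ a ∈ ideal K, T.res (quot h) a ∈ ideal H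
  tr_mem : ∀ {H K : Subgroup G} (h : H ≤ K), ∀ a ∈ ideal H, T.tr (quot h) a ∈ ideal K
  nm_mem : ∀ {H K : Subgroup G} (h : H ≤ K), ∀ a ∈ ideal H, T.nm (quot h) a ∈ ideal K
  conj_mem : ∀ (g : G) (H : Subgroup G), ∀ a ∈ ideal H,
    T.tr (conjMap g H) a ∈ ideal (conjSubgroup g H)

/-- The Weyl action of `g ∈ G` on `T(G/e)`. -/
def weyl (g : G) (a : T.level (⊥ : Subgroup G)) : T.level (⊥ : Subgroup G) := T.tr (weylMap g) a

end TambaraFunctor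

namespace TambaraFunctor

open FinGSet

variable {G : Type u} [Group G]

/-! The proof compares `T` with fixed point functors. For a ring `R` with trivial action, the
invariant functions `X → R` form a Tambara functor `fixedPoint G R`, with sums and products over
fibres as transfers and norms. Restricting `a` in `T(X)` along all the maps `G/e → X` gives a
function `X → T(G/e)`. Trivial Weyl action makes this function invariant, and base change along
points makes the assignment compatible with transfers and norms. So each ring homomorphism `T(G/e) →
R` induces a morphism `toFixedPoint` from `T` to `fixedPoint G R`. At `G/H` it sends `x` to the
constant function with value the image of `y = res x` in `R`.

If `y` is nilpotent, its image in `T[1/x](G/e)` is a nilpotent unit, so that ring is zero; a Tambara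
functor that vanishes at `G/e` vanishes everywhere, by norms along surjections
(`isZero_of_subsingleton_bot`). Conversely, with `R = T(G/e)[1/y]` the morphism inverts `x` and so
factors through `T[1/x]`. If `T[1/x] = 0`, then `R = 0` and `y` is nilpotent
(`isNilpotent_res_of_isKilpotent`).

For `R` the quotient of `T(G/e)` by its nilradical, the kernel of `toFixedPoint` is the set of `x`
with nilpotent restriction, and kernels are Tambara ideals (`Mor.ker`). -/

/-- The ring of `G`-invariant functions `X → R`. -/
def invariantFunctions (R : Type v) [CommRing R] (X : FinGSet G) : Subring (X → R) where
  carrier := {φ | ∀ (g : G) (x : X), φ (g • x) = φ x}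
  mul_mem' ha hb g x := by simp [ha g x, hb g x]
  one_mem' _ _ := rfl
  add_mem' ha hb g x := by simp [ha g x, hb g x]
  zero_mem' _ _ := rfl
  neg_mem' ha g x := by simp [ha g x]

noncomputable instance (X : FinGSet G) : Fintype X := Fintype.ofFinite X

/-! ### Products and sums over the fibres of equivariant maps -/

section FibreProducts

open scoped Classical in
/-- The product of a function over the fibres of an equivariant map. -/
noncomputable def fibreProd {M : Type v} [CommMonoid M] {X Y : FinGSet G} (f : Hom X Y)
    (φ : X → M) (y : Y) : M :=
  ∏ x with f x = y, φ x

variable {M : Type v} [CommMonoid M]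

theorem fibreProd_smul {X Y : FinGSet G} (f : Hom X Y) {φ : X → M}
    (hφ : ∀ (g : G) (x : X), φ (g • x) = φ x) (g : G) (y : Y) :
    fibreProd f φ (g • y) = fibreProd f φ y := by
  classical
  unfold fibreProd
  refine Finset.prod_nbij' (fun x => g⁻¹ • x) (fun x => g • x) ?_ ?_ ?_ ?_ ?_
  · intro x hx
    simp only [Finset.mem_filter, Finset.mem_univ, true_and] at hx ⊢
    rw [map_smul, hx, inv_smul_smul]
  · intro x hx
    simp only [Finset.mem_filter, Finset.mem_univ, true_and] at hx ⊢
    rw [map_smul, hx]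
  · intro x _
    exact smul_inv_smul g x
  · intro x _
    exact inv_smul_smul g x
  · intro x _
    exact (hφ g⁻¹ x).symm

theorem fibreProd_id {X : FinGSet G} (φ : X → M) : fibreProd (MulActionHom.id G) φ = φ := by
  classical
  funext x
  simp [fibreProd, Finset.prod_filter]

theorem fibreProd_comp {X Y Z : FinGSet G} (f : Hom Y Z) (g : Hom X Y) (φ : X → M) :
    fibreProd (f.comp g) φ = fibreProd f (fibreProd g φ) := by
  classical
  funext z
  simp only [fibreProd, Finset.prod_filter, MulActionHom.comp_apply]
  have : ∀ y : Y, (if f y = z then ∏ x, (if g x = y then φ x else 1) else 1) =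
      ∏ x, if g x = y then (if f y = z then φ x else 1) else 1 := by
    intro y
    split_ifs <;> simp
  simp only [this]
  rw [Finset.prod_comm]
  simp

/-- In a pullback square, `q` maps the fibre of `p` over `x` bijectively onto the fibre of `g` over
`f x`. -/
theorem fibreProd_baseChange {P X Y Z : FinGSet G} {p : Hom P X} {q : Hom P Y} {f : Hom X Z}
    {g : Hom Y Z} (h : IsPullback p q f g) (φ : Y → M) (x : X) :
    fibreProd g φ (f x) = fibreProd p (φ ∘ q) x := by
  classical
  unfold fibreProd
  symm
  refine Finset.prod_bij (fun a _ => q a) ?_ ?_ ?_ ?_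
  · intro a ha
    simp only [Finset.mem_filter, Finset.mem_univ, true_and] at ha ⊢
    rw [← h.1, ha]
  · intro a ha b hb hab
    simp only [Finset.mem_filter, Finset.mem_univ, true_and] at ha hb
    exact (h.2 x (q a) (by rw [← ha, h.1])).unique ⟨ha, rfl⟩ ⟨hb, hab.symm⟩
  · intro y hy
    simp only [Finset.mem_filter, Finset.mem_univ, true_and] at hy
    obtain ⟨a, ha, -⟩ := h.2 x y hy.symm
    exact ⟨a, by simpa using ha.1, ha.2⟩
  · intro a _
    rfl

theorem fibreProd_fromEmpty (X : FinGSet G) (φ : FinGSet.empty G → M) (x : X) :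
    fibreProd (fromEmpty X) φ x = 1 :=
  Finset.prod_eq_one fun a _ => PEmpty.elim a

theorem fibreProd_fold (X : FinGSet G) (φ : coprod X X → M) (x : X) :
    fibreProd (fold X) φ x = φ (inl X X x) * φ (inr X X x) := by
  classical
  have : ∀ s : Finset (coprod X X), s = {inl X X x, inr X X x} →
      ∏ a ∈ s, φ a = φ (inl X X x) * φ (inr X X x) := by
    rintro s rfl
    exact Finset.prod_pair Sum.inl_ne_inr
  apply this
  ext a
  simp only [Finset.mem_filter, Finset.mem_univ, true_and, Finset.mem_insert,
    Finset.mem_singleton]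
  constructor
  · rcases a with a | a
    · rintro rfl; exact Or.inl rfl
    · rintro rfl; exact Or.inr rfl
  · rintro (rfl | rfl) <;> rfl

end FibreProducts

section FibreSums

open scoped Classical in
/-- The sum of a function over the fibres of an equivariant map. -/
noncomputable def fibreSum {M : Type v} [AddCommMonoid M] {X Y : FinGSet G} (f : Hom X Y)
    (φ : X → M) (y : Y) : M :=
  ∑ x with f x = y, φ x

variable {M : Type v} [AddCommMonoid M]

/-- Fibre sums are definitionally fibre products in `Multiplicative M`, so every additive law below
is an instance of the multiplicative one. -/
theorem fibreSum_smul {X Y : FinGSet G} (f : Hom X Y) {φ : X → M}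
    (hφ : ∀ (g : G) (x : X), φ (g • x) = φ x) (g : G) (y : Y) :
    fibreSum f φ (g • y) = fibreSum f φ y :=
  fibreProd_smul (M := Multiplicative M) f hφ g y

theorem fibreSum_id {X : FinGSet G} (φ : X → M) : fibreSum (MulActionHom.id G) φ = φ :=
  fibreProd_id (M := Multiplicative M) φ

theorem fibreSum_comp {X Y Z : FinGSet G} (f : Hom Y Z) (g : Hom X Y) (φ : X → M) :
    fibreSum (f.comp g) φ = fibreSum f (fibreSum g φ) :=
  fibreProd_comp (M := Multiplicative M) f g φ

theorem fibreSum_baseChange {P X Y Z : FinGSet G} {p : Hom P X} {q : Hom P Y} {f : Hom X Z}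
    {g : Hom Y Z} (h : IsPullback p q f g) (φ : Y → M) (x : X) :
    fibreSum g φ (f x) = fibreSum p (φ ∘ q) x :=
  fibreProd_baseChange (M := Multiplicative M) h φ x

theorem fibreSum_fromEmpty (X : FinGSet G) (φ : FinGSet.empty G → M) (x : X) :
    fibreSum (fromEmpty X) φ x = 0 :=
  fibreProd_fromEmpty (M := Multiplicative M) X φ x

theorem fibreSum_fold (X : FinGSet G) (φ : coprod X X → M) (x : X) :
    fibreSum (fold X) φ x = φ (inl X X x) + φ (inr X X x) :=
  fibreProd_fold (M := Multiplicative M) X φ x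

end FibreSums

/-- The distributive law for fibrewise sums and products. -/
theorem fibreProd_fibreSum {R : Type v} [CommRing R] {X Y Z P E : FinGSet G} {g : Hom X Y}
    {f : Hom Y Z} {π : Hom P Z} {f' : Hom E P} {e : Hom E Y} {ε : Hom E X}
    (h : IsExponential g f π f' e ε) (φ : X → R) :
    fibreProd f (fibreSum g φ) = fibreSum π (fibreProd f' (φ ∘ ε)) := by
  classical
  funext z
  obtain ⟨⟨hc, hp⟩, hε, hs⟩ := h
  unfold fibreProd fibreSum
  -- Expanding gives a sum over choice functions on `f⁻¹(z)`, that is, over sections of `g` there;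
  -- the exponential property matches these with the fibre of `π` over `z`.
  rw [Finset.prod_sum]
  symm
  -- By the pullback square, `b` over `z` has exactly one point `l b y` of `E` over each `y` in
  -- `f⁻¹(z)`; the section belonging to `b` is `y ↦ ε (l b y)`.
  have lift : ∀ (b : P) (_ : π b = z) (y : Y) (_ : f y = z), ∃ a : E, e a = y ∧ f' a = b :=
    fun b hb y hy => (hp y b (hy.trans hb.symm)).exists
  choose l hle hlf using lift
  have mz : ∀ {b : P}, b ∈ Finset.univ.filter (fun b => π b = z) → π b = z := fun h => by
    simpa using h
  have mf : ∀ {y : Y}, y ∈ Finset.univ.filter (fun y => f y = z) → f y = z := fun h => by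
    simpa using h
  refine Finset.sum_bij (fun b hb y hy => ε (l b (mz hb) y (mf hy))) ?_ ?_ ?_ ?_
  · intro b hb
    simp only [Finset.mem_filter, Finset.mem_univ, true_and, Finset.mem_pi] at hb ⊢
    intro y hy
    rw [hε, hle b hb y hy]
  · intro b hb c hc' hbc
    simp only [Finset.mem_filter, Finset.mem_univ, true_and] at hb hc'
    refine (hs z (fun y => ε (l b hb y y.2)) fun y => by rw [hε, hle b hb y y.2]).unique
      ⟨hb, fun a y ha hy => ?_⟩ ⟨hc', fun a y ha hy => ?_⟩
    · exact congrArg ε ((hp y b (y.2.trans hb.symm)).unique ⟨hy, ha⟩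
        ⟨hle b hb y y.2, hlf b hb y y.2⟩)
    · have := congrFun (congrFun hbc y.1) (by simpa using y.2)
      rw [show ε (l b hb y y.2) = ε (l c hc' y y.2) from this]
      exact congrArg ε ((hp y c (y.2.trans hc'.symm)).unique ⟨hy, ha⟩
        ⟨hle c hc' y y.2, hlf c hc' y y.2⟩)
  · intro s hsm
    simp only [Finset.mem_filter, Finset.mem_univ, true_and, Finset.mem_pi] at hsm
    obtain ⟨b, ⟨hb, hb'⟩, -⟩ := hs z (fun y => s y.1 (by simpa using y.2)) fun y => hsm y.1 y.2
    refine ⟨b, by simpa using hb, ?_⟩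
    funext y hy
    have hy' : f y = z := by simpa using hy
    exact hb' (l b hb y hy') ⟨y, hy'⟩ (hlf b hb y hy') (hle b hb y hy')
  · intro b hb
    simp only [Finset.mem_filter, Finset.mem_univ, true_and] at hb
    symm
    -- The same lifts identify `f⁻¹(z)` with the fibre of `f'` over `b`, so the two products agree
    -- factor by factor.
    refine Finset.prod_bij (fun y _ => l b hb y.1 (mf y.2)) ?_ ?_ ?_ ?_
    · rintro ⟨y, hy⟩ -
      simp only [Finset.mem_filter, Finset.mem_univ, true_and] at hy ⊢
      exact hlf b hb y hy
    · rintro ⟨y, hy⟩ - ⟨y', hy'⟩ - hyy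
      simp only [Finset.mem_filter, Finset.mem_univ, true_and] at hy hy'
      simp only [Subtype.mk.injEq]
      rw [← hle b hb y hy, ← hle b hb y' hy']
      exact congrArg e hyy
    · intro a ha
      simp only [Finset.mem_filter, Finset.mem_univ, true_and] at ha
      have hz : f (e a) = z := by rw [hc, ha, hb]
      exact ⟨⟨e a, by simpa using hz⟩, Finset.mem_attach _ _,
        (hp (e a) b (hz.trans hb.symm)).unique ⟨hle b hb _ hz, hlf b hb _ hz⟩ ⟨rfl, ha⟩⟩
    · intro y _
      rfl

/-- The fixed point Tambara functor of a commutative ring with trivial `G`-action. -/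
noncomputable def fixedPoint (G : Type u) [Group G] (R : Type v) [CommRing R] :
    TambaraFunctor.{u, max u v} G where
  obj X := invariantFunctions R X
  tr f φ := ⟨fibreSum f φ.1, fibreSum_smul f φ.2⟩
  nm f φ := ⟨fibreProd f φ.1, fibreProd_smul f φ.2⟩
  res f φ := ⟨φ.1 ∘ f, fun g x => by simp [φ.2 g]⟩
  tr_id φ := Subtype.ext (fibreSum_id φ.1)
  nm_id φ := Subtype.ext (fibreProd_id φ.1)
  res_id _ := rfl
  tr_comp f g φ := Subtype.ext (fibreSum_comp f g φ.1)
  nm_comp f g φ := Subtype.ext (fibreProd_comp f g φ.1)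
  res_comp _ _ _ := rfl
  res_tr _ _ _ _ h φ := Subtype.ext (funext (fibreSum_baseChange h φ.1))
  res_nm _ _ _ _ h φ := Subtype.ext (funext (fibreProd_baseChange h φ.1))
  nm_tr _ _ _ _ _ _ h φ := Subtype.ext (fibreProd_fibreSum h φ.1)
  obj_empty := ⟨fun _ _ => Subtype.ext (funext fun a => PEmpty.elim a)⟩
  obj_coprod X Y := by
    constructor
    · intro φ ψ h
      obtain ⟨h₁, h₂⟩ := Prod.ext_iff.1 h
      refine Subtype.ext (funext ?_)
      rintro (a | a)
      · exact congrFun (congrArg Subtype.val h₁) a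
      · exact congrFun (congrArg Subtype.val h₂) a
    · rintro ⟨φ, ψ⟩
      exact ⟨⟨Sum.elim φ.1 ψ.1, by rintro g (a | a); exacts [φ.2 g a, ψ.2 g a]⟩, rfl⟩
  tr_fromEmpty X φ := Subtype.ext (funext (fibreSum_fromEmpty X φ.1))
  nm_fromEmpty X φ := Subtype.ext (funext (fibreProd_fromEmpty X φ.1))
  tr_fold X φ := Subtype.ext (funext (fibreSum_fold X φ.1))
  nm_fold X φ := Subtype.ext (funext (fibreProd_fold X φ.1))

/-! ### Standard pullback squares and exponential diagrams -/

theorem isPullback_id_of_bijective {X Y : FinGSet G} {m : Hom X Y} (hm : Function.Bijective m) :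
    IsPullback m m (MulActionHom.id G) (MulActionHom.id G) := by
  refine ⟨fun _ => rfl, ?_⟩
  rintro y _ rfl
  obtain ⟨a, rfl⟩ := hm.2 y
  exact ⟨a, ⟨rfl, rfl⟩, fun b hb => hm.1 hb.1⟩

theorem isPullback_id_self {X Y : FinGSet G} {m : Hom X Y} (hm : Function.Injective m) :
    IsPullback (MulActionHom.id G) (MulActionHom.id G) m m :=
  ⟨fun _ => rfl, fun x _ h => ⟨x, ⟨rfl, hm h⟩, fun _ hb => hb.1⟩⟩

/-- The map out of a disjoint union given by maps out of the summands. -/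
def coprodDesc {X Y Z : FinGSet G} (f : Hom X Z) (g : Hom Y Z) : Hom (coprod X Y) Z where
  toFun := Sum.elim f g
  map_smul' := by rintro m (a | a); exacts [map_smul f m a, map_smul g m a]

/-- The disjoint union of two maps. -/
def coprodMap {X Y Z W : FinGSet G} (f : Hom X Z) (g : Hom Y W) :
    Hom (coprod X Y) (coprod Z W) :=
  coprodDesc ((inl Z W).comp f) ((inr Z W).comp g)

theorem isPullback_inl_coprodMap {X Y Z W : FinGSet G} (f : Hom X Z) (g : Hom Y W) :
    IsPullback f (inl X Y) (inl Z W) (coprodMap f g) := by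
  refine ⟨fun _ => rfl, ?_⟩
  rintro z (x | y) h
  · exact ⟨x, ⟨(Sum.inl_injective h).symm, rfl⟩, fun b hb => Sum.inl_injective hb.2⟩
  · exact absurd h Sum.inl_ne_inr

theorem isPullback_inr_coprodMap {X Y Z W : FinGSet G} (f : Hom X Z) (g : Hom Y W) :
    IsPullback g (inr X Y) (inr Z W) (coprodMap f g) := by
  refine ⟨fun _ => rfl, ?_⟩
  rintro z (x | y) h
  · exact absurd h Sum.inr_ne_inl
  · exact ⟨y, ⟨(Sum.inr_injective h).symm, rfl⟩, fun b hb => Sum.inr_injective hb.2⟩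

theorem fold_comp_coprodMap {X Y Z : FinGSet G} (f : Hom X Z) (g : Hom Y Z) :
    (fold Z).comp (coprodMap f g) = coprodDesc f g := by
  ext (a | a) <;> rfl

theorem isPullback_fold {X Y : FinGSet G} (f : Hom X Y) :
    IsPullback (fold X) (coprodMap f f) f (fold Y) := by
  constructor
  · rintro (a | a) <;> rfl
  · rintro x (y | y) h
    · exact ⟨inl X X x, ⟨rfl, congrArg Sum.inl h⟩, by
        rintro (b | b) hb
        · exact congrArg Sum.inl hb.1
        · exact absurd hb.2 Sum.inr_ne_inl⟩
    · exact ⟨inr X X x, ⟨rfl, congrArg Sum.inr h⟩, by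
        rintro (b | b) hb
        · exact absurd hb.2 Sum.inl_ne_inr
        · exact congrArg Sum.inr hb.1⟩

theorem isPullback_fromEmpty {X Y : FinGSet G} (f : Hom X Y) :
    IsPullback (fromEmpty X) (MulActionHom.id G) f (fromEmpty Y) :=
  ⟨fun a => PEmpty.elim a, fun _ a => PEmpty.elim a⟩

/-- Over a nonempty fibre of `f` the map from the empty set has no section, so its dependent product
along a surjection is empty. -/
theorem isExponential_empty {Y Z : FinGSet G} {f : Hom Y Z} (hf : Function.Surjective f) :
    IsExponential (fromEmpty Y) f (fromEmpty Z) (MulActionHom.id G) (fromEmpty Y)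
      (MulActionHom.id G) := by
  refine ⟨⟨fun a => PEmpty.elim a, fun _ a => PEmpty.elim a⟩, fun a => PEmpty.elim a, ?_⟩
  intro z s _
  obtain ⟨y, hy⟩ := hf z
  exact PEmpty.elim (s ⟨y, hy⟩)

/-! ### Additivity of transfers and norms, and restriction as a ring map -/

section Additivity

variable (T : TambaraFunctor.{u, v} G)

theorem tr_coprodDesc {X Y Z : FinGSet G} (f : Hom X Z) (g : Hom Y Z) (c : T.obj (coprod X Y)) :
    T.tr (coprodDesc f g) c = T.tr f (T.res (inl X Y) c) + T.tr g (T.res (inr X Y) c) := by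
  rw [← fold_comp_coprodMap, T.tr_comp, T.tr_fold,
    T.res_tr _ _ _ _ (isPullback_inl_coprodMap f g),
    T.res_tr _ _ _ _ (isPullback_inr_coprodMap f g)]

theorem nm_coprodDesc {X Y Z : FinGSet G} (f : Hom X Z) (g : Hom Y Z) (c : T.obj (coprod X Y)) :
    T.nm (coprodDesc f g) c = T.nm f (T.res (inl X Y) c) * T.nm g (T.res (inr X Y) c) := by
  rw [← fold_comp_coprodMap, T.nm_comp, T.nm_fold,
    T.res_nm _ _ _ _ (isPullback_inl_coprodMap f g),
    T.res_nm _ _ _ _ (isPullback_inr_coprodMap f g)]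

theorem tr_res_of_bijective {X Y : FinGSet G} {m : Hom X Y} (hm : Function.Bijective m)
    (c : T.obj Y) : T.tr m (T.res m c) = c := by
  rw [← T.res_tr _ _ _ _ (isPullback_id_of_bijective hm), T.tr_id, T.res_id]

theorem nm_res_of_bijective {X Y : FinGSet G} {m : Hom X Y} (hm : Function.Bijective m)
    (c : T.obj Y) : T.nm m (T.res m c) = c := by
  rw [← T.res_nm _ _ _ _ (isPullback_id_of_bijective hm), T.nm_id, T.res_id]

theorem res_tr_of_injective {X Y : FinGSet G} {m : Hom X Y} (hm : Function.Injective m)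
    (c : T.obj X) : T.res m (T.tr m c) = c := by
  rw [T.res_tr _ _ _ _ (isPullback_id_self hm), T.res_id, T.tr_id]

theorem tr_zero {X Y : FinGSet G} (f : Hom X Y) : T.tr f 0 = 0 := by
  rw [← T.tr_fromEmpty X 0, ← T.tr_comp,
    show f.comp (fromEmpty X) = fromEmpty Y from MulActionHom.ext fun a => PEmpty.elim a,
    T.tr_fromEmpty]

theorem nm_one {X Y : FinGSet G} (f : Hom X Y) : T.nm f 1 = 1 := by
  rw [← T.nm_fromEmpty X 0, ← T.nm_comp,
    show f.comp (fromEmpty X) = fromEmpty Y from MulActionHom.ext fun a => PEmpty.elim a,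
    T.nm_fromEmpty]

/-- Zero is a transfer from the empty set, and the distributive law moves the norm inside that
transfer. Surjectivity matters: an empty fibre contributes an empty product, which is `1`. -/
theorem nm_zero {X Y : FinGSet G} {f : Hom X Y} (hf : Function.Surjective f) : T.nm f 0 = 0 := by
  rw [← T.tr_fromEmpty X 0, T.nm_tr _ _ _ _ _ _ (isExponential_empty hf), T.tr_fromEmpty]

/-- Restriction as a ring homomorphism. -/
def resHom {X Y : FinGSet G} (f : Hom X Y) : T.obj Y →+* T.obj X where
  toFun := T.res f
  map_zero' := by
    rw [← T.tr_fromEmpty Y 0, T.res_tr _ _ _ _ (isPullback_fromEmpty f), T.tr_fromEmpty]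
  map_one' := by
    rw [← T.nm_fromEmpty Y 0, T.res_nm _ _ _ _ (isPullback_fromEmpty f), T.nm_fromEmpty]
  map_add' a b := by
    obtain ⟨c, hc⟩ := (T.obj_coprod Y Y).2 (a, b)
    obtain ⟨rfl, rfl⟩ := Prod.ext_iff.1 hc
    rw [← T.tr_fold, T.res_tr _ _ _ _ (isPullback_fold f), T.tr_fold]
    simp only [← T.res_comp]
    rfl
  map_mul' a b := by
    obtain ⟨c, hc⟩ := (T.obj_coprod Y Y).2 (a, b)
    obtain ⟨rfl, rfl⟩ := Prod.ext_iff.1 hc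
    rw [← T.nm_fold, T.res_nm _ _ _ _ (isPullback_fold f), T.nm_fold]
    simp only [← T.res_comp]
    rfl

end Additivity

/-- A morphism of Tambara functors is a ring homomorphism at each finite `G`-set. -/
def Mor.ringHom {T : TambaraFunctor.{u, v} G} {S : TambaraFunctor.{u, w} G} (φ : Mor T S)
    (X : FinGSet G) : T.obj X →+* S.obj X where
  toFun := φ.app X
  map_zero' := φ.app_zero X
  map_one' := φ.app_one X
  map_add' := φ.app_add
  map_mul' := φ.app_mul

/-! ### Transfers and norms along trivial coverings -/

section Copies

/-- The disjoint union of copies of `Z` indexed by `I`. -/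
def copies (I : Type u) [Finite I] (Z : FinGSet G) : FinGSet G where
  carrier := Σ _ : I, Z

/-- The map from a disjoint union of copies of `Z` given by a family of maps. -/
def copiesDesc {I : Type u} [Finite I] {Z X : FinGSet G} (f : I → Hom Z X) :
    Hom (copies I Z) X where
  toFun a := f a.1 a.2
  map_smul' m a := map_smul (f a.1) m a.2

/-- The inclusion of the copy of `Z` with index `i`. -/
def copiesIncl {I : Type u} [Finite I] (Z : FinGSet G) (i : I) : Hom Z (copies I Z) where
  toFun z := ⟨i, z⟩
  map_smul' _ _ := rfl

variable (T : TambaraFunctor.{u, v} G)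

/-- If `P` is the disjoint union of copies of `Z`, embedded by sections `s i` of `p`, then transfer
and norm along `p : P → Z` are the sum and product of the restrictions along the `s i`. -/
theorem tr_nm_of_sections {Z : FinGSet G} (I : Type u) [hI : Fintype I] :
    ∀ (P : FinGSet G) (p : Hom P Z) (s : I → Hom Z P), (∀ i, p.comp (s i) = MulActionHom.id G) →
      Function.Bijective (copiesDesc s) → ∀ c : T.obj P,
        T.tr p c = ∑ i, T.res (s i) c ∧ T.nm p c = ∏ i, T.res (s i) c := by
  -- The axioms only cover empty and binary disjoint unions, so the index set is built up one
  -- element at a time.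
  refine Fintype.induction_empty_option ?_ ?_ ?_ I (h_fintype := hI)
  · intro α β _ e ih P p s hs hb c
    let _ := Fintype.ofEquiv β e.symm
    have hb' : Function.Bijective (copiesDesc (s ∘ e)) :=
      hb.comp (Equiv.sigmaCongrLeft (β := fun _ : β => Z.carrier) e).bijective
    obtain ⟨h₁, h₂⟩ := ih P p (s ∘ e) (fun i => hs (e i)) hb' c
    rw [h₁, h₂]
    exact ⟨e.sum_comp fun i => T.res (s i) c, e.prod_comp fun i => T.res (s i) c⟩
  · intro P p s hs hb c
    have hm : Function.Bijective (fromEmpty P) :=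
      ⟨fun a => PEmpty.elim a, fun a => PEmpty.elim (hb.2 a).choose.1⟩
    have hp : p.comp (fromEmpty P) = fromEmpty Z := MulActionHom.ext fun a => PEmpty.elim a
    constructor
    · conv_lhs => rw [← T.tr_res_of_bijective hm c, ← T.tr_comp, hp, T.tr_fromEmpty]
      simp
    · conv_lhs => rw [← T.nm_res_of_bijective hm c, ← T.nm_comp, hp, T.nm_fromEmpty]
      simp
  · intro α _ ih P p s hs hb c
    -- The copy indexed by `none` is split off; the bijection `m` lets `p` be replaced by a map out
    -- of a binary disjoint union.
    let m : Hom (coprod (copies α Z) Z) P := coprodDesc (copiesDesc fun i => s (some i)) (s none)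
    have hm : Function.Bijective m := by
      constructor
      · have key : ∀ i j a b, s i a = s j b → (⟨i, a⟩ : Σ _ : Option α, Z.carrier) = ⟨j, b⟩ :=
          fun _ _ _ _ h => hb.1 h
        rintro (⟨i, a⟩ | a) (⟨j, b⟩ | b) hab
        · cases key (some i) (some j) a b hab
          rfl
        · cases key (some i) none a b hab
        · cases key none (some j) a b hab
        · cases key none none a b hab
          rfl
      · intro x
        obtain ⟨⟨_ | i, a⟩, rfl⟩ := hb.2 x
        · exact ⟨inr _ _ a, rfl⟩
        · exact ⟨inl _ _ ⟨i, a⟩, rfl⟩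
    let p' : Hom (copies α Z) Z := copiesDesc fun _ => MulActionHom.id G
    have hp : p.comp m = coprodDesc p' (MulActionHom.id G) := by
      ext (⟨i, a⟩ | a)
      · exact DFunLike.congr_fun (hs (some i)) a
      · exact DFunLike.congr_fun (hs none) a
    obtain ⟨h₁, h₂⟩ := ih _ p' (copiesIncl Z) (fun _ => rfl) Function.bijective_id
      (T.res (inl _ _) (T.res m c))
    have hr : ∀ i, T.res (copiesIncl Z i) (T.res (inl _ _) (T.res m c)) = T.res (s (some i)) c := by
      intro i
      rw [← T.res_comp, ← T.res_comp]
      rfl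
    have hr' : T.res (inr _ _) (T.res m c) = T.res (s none) c := by
      rw [← T.res_comp]
      rfl
    constructor
    · conv_lhs => rw [← T.tr_res_of_bijective hm c, ← T.tr_comp, hp, T.tr_coprodDesc, T.tr_id, h₁]
      rw [Fintype.sum_option, add_comm, hr', Finset.sum_congr rfl fun i _ => hr i]
    · conv_lhs => rw [← T.nm_res_of_bijective hm c, ← T.nm_comp, hp, T.nm_coprodDesc, T.nm_id, h₂]
      rw [Fintype.prod_option, mul_comm, hr', Finset.prod_congr rfl fun i _ => hr i]

end Copies

/-! ### Restriction to points and the comparison with fixed point functors -/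

section Points

variable [Finite G]

/-- The map `G/e → X` that sends the base point to `x`. -/
def point {X : FinGSet G} (x : X) : Hom (orbit (⊥ : Subgroup G)) X where
  toFun := Quotient.lift (fun g : G => g • x) (fun a b hab => by
    have h := QuotientGroup.leftRel_apply.1 hab
    rw [Subgroup.mem_bot, inv_mul_eq_one] at h
    rw [h])
  map_smul' := by
    rintro m ⟨a⟩
    exact mul_smul m a x

theorem comp_point {X Y : FinGSet G} (f : Hom X Y) (x : X) : f.comp (point x) = point (f x) := by
  refine MulActionHom.ext ?_
  rintro ⟨a⟩
  exact map_smul f a x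

theorem point_smul {X : FinGSet G} (g : G) (x : X) :
    point (g • x) = (point x).comp (weylMap g⁻¹) := by
  refine MulActionHom.ext ?_
  rintro ⟨a⟩
  change a • g • x = (a * g⁻¹⁻¹) • x
  rw [inv_inv, mul_smul]

theorem point_mk_one (H : Subgroup G) :
    point (X := orbit H) (QuotientGroup.mk (s := H) 1 : G ⧸ H) = quot (bot_le : ⊥ ≤ H) := by
  refine MulActionHom.ext ?_
  rintro ⟨a⟩
  exact congrArg (QuotientGroup.mk (s := H)) (mul_one a)

theorem weylMap_injective (g : G) : Function.Injective (weylMap g) := by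
  rintro ⟨a⟩ ⟨b⟩ hab
  have h : (QuotientGroup.mk (a * g⁻¹) : G ⧸ (⊥ : Subgroup G)) = QuotientGroup.mk (b * g⁻¹) := hab
  rw [QuotientGroup.eq, Subgroup.mem_bot, inv_mul_eq_one] at h
  rw [mul_right_cancel h]

/-- Pulling `f` back along a map from the free orbit gives a trivial covering indexed by the fibre
over `y`: a pair `(a, x)` with `a • y = f x` corresponds to the fibre element `a⁻¹ • x` in the copy
at `a`. -/
theorem isPullback_point {X Y : FinGSet G} (f : Hom X Y) (y : Y) :
    IsPullback (copiesDesc fun _ : {x : X // f x = y} => MulActionHom.id G)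
      (copiesDesc fun x : {x : X // f x = y} => point x.1) (point y) f := by
  constructor
  · rintro ⟨⟨x, rfl⟩, a⟩
    exact (DFunLike.congr_fun (comp_point f x) a).symm
  · rintro ⟨a⟩ x h
    have h' : a • y = f x := h
    refine ⟨⟨⟨a⁻¹ • x, by rw [map_smul, ← h', inv_smul_smul]⟩, QuotientGroup.mk a⟩,
      ⟨rfl, smul_inv_smul a x⟩, ?_⟩
    rintro ⟨⟨x', hx'⟩, b⟩ ⟨hb, hb'⟩
    change b = QuotientGroup.mk a at hb
    subst hb
    change a • x' = x at hb'
    subst hb'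
    have hx : a⁻¹ • a • x' = x' := inv_smul_smul a x'
    exact congrArg
      (fun i => (⟨i, QuotientGroup.mk a⟩ : Σ _ : {x : X // f x = y}, G ⧸ (⊥ : Subgroup G)))
      (Subtype.ext hx.symm)

variable (T : TambaraFunctor.{u, v} G)

/-- Base change reduces the transfer to one along a trivial covering, where it is a sum. This is the
compatibility with transfers that `toFixedPoint` needs. -/
theorem res_point_tr {X Y : FinGSet G} (f : Hom X Y) (y : Y) (a : T.obj X) :
    T.res (point y) (T.tr f a) = fibreSum f (fun x => T.res (point x) a) y := by
  classical
  rw [T.res_tr _ _ _ _ (isPullback_point f y),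
    (tr_nm_of_sections T {x : X // f x = y} _ _ (copiesIncl _) (fun _ => rfl)
      Function.bijective_id _).1]
  simp only [← T.res_comp]
  exact (Finset.sum_subtype _ (by simp) fun x => T.res (point x) a).symm

theorem res_point_nm {X Y : FinGSet G} (f : Hom X Y) (y : Y) (a : T.obj X) :
    T.res (point y) (T.nm f a) = fibreProd f (fun x => T.res (point x) a) y := by
  classical
  rw [T.res_nm _ _ _ _ (isPullback_point f y),
    (tr_nm_of_sections T {x : X // f x = y} _ _ (copiesIncl _) (fun _ => rfl)
      Function.bijective_id _).2]
  simp only [← T.res_comp]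
  exact (Finset.prod_subtype _ (by simp) fun x => T.res (point x) a).symm

variable {T}

/-- Here the trivial Weyl action enters: moving the point by `g` restricts along a Weyl
automorphism, and that restriction undoes the transfer along the same automorphism, which is the
identity by `hT`. -/
theorem res_point_smul (hT : ∀ (g : G) (a : T.level (⊥ : Subgroup G)), T.weyl g a = a)
    {X : FinGSet G} (a : T.obj X) (g : G) (x : X) :
    T.res (point (g • x)) a = T.res (point x) a := by
  rw [point_smul, T.res_comp]
  conv_lhs => rw [← hT g⁻¹ (T.res (point x) a)]
  exact T.res_tr_of_injective (weylMap_injective g⁻¹) _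

theorem res_point_orbit (hT : ∀ (g : G) (a : T.level (⊥ : Subgroup G)), T.weyl g a = a)
    {H : Subgroup G} (a : T.level H) (x : orbit H) :
    T.res (point x) a = T.res (quot (bot_le : ⊥ ≤ H)) a := by
  obtain ⟨g⟩ := x
  have : (Quot.mk _ g : G ⧸ H) = g • (QuotientGroup.mk 1 : G ⧸ H) :=
    congrArg (QuotientGroup.mk (s := H)) (mul_one g).symm
  rw [← point_mk_one]
  exact (congrArg (fun x : orbit H => T.res (point x) a) this).trans (res_point_smul hT a g _)

/-- When the Weyl action on `T(G/e)` is trivial, a ring homomorphism out of `T(G/e)` induces a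
morphism from `T` to a fixed point Tambara functor. -/
noncomputable def toFixedPoint
    (hT : ∀ (g : G) (a : T.level (⊥ : Subgroup G)), T.weyl g a = a) {R : Type w} [CommRing R]
    (φ : T.level (⊥ : Subgroup G) →+* R) : Mor T (fixedPoint G R) where
  app X a := ⟨fun x => φ (T.res (point x) a), fun g x =>
    congrArg φ (res_point_smul hT a g x)⟩
  app_tr f a := Subtype.ext <| funext fun y =>
    (congrArg φ (res_point_tr T f y a)).trans (map_sum φ _ _)
  app_nm f a := Subtype.ext <| funext fun y =>
    (congrArg φ (res_point_nm T f y a)).trans (map_prod φ _ _)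
  app_res f a := Subtype.ext <| funext fun x => by
    change φ (T.res (point x) (T.res f a)) = φ (T.res (point (f x)) a)
    rw [← T.res_comp, comp_point]

theorem toFixedPoint_orbit_apply
    (hT : ∀ (g : G) (a : T.level (⊥ : Subgroup G)), T.weyl g a = a) {R : Type w} [CommRing R]
    (φ : T.level (⊥ : Subgroup G) →+* R) {H : Subgroup G} (a : T.level H) (x : orbit H) :
    ((toFixedPoint hT φ).app (orbit H) a).1 x = φ (T.res (quot (bot_le : ⊥ ≤ H)) a) :=
  congrArg φ (res_point_orbit hT a x)

/-! ### Kilpotence and nilpotence of the restriction to `G/e` -/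

/-- Every `X` is covered by a disjoint union `P` of free orbits, which also maps to `G/e`.
Restriction from `G/e` forces `1 = 0` on `P`, and the norm along the surjection `P → X` preserves
both `1` and `0`. -/
theorem isZero_of_subsingleton_bot (S : TambaraFunctor.{u, v} G)
    (h : Subsingleton (S.level (⊥ : Subgroup G))) : S.IsZero := by
  intro X
  let P : FinGSet G := copies X (orbit (⊥ : Subgroup G))
  let p : Hom P (orbit ⊥) := copiesDesc fun _ => MulActionHom.id G
  let q : Hom P X := copiesDesc point
  have hq : Function.Surjective q := fun x => ⟨⟨x, QuotientGroup.mk 1⟩, one_smul G x⟩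
  have hP : (1 : S.obj P) = 0 := by
    rw [← map_one (S.resHom p), ← map_zero (S.resHom p), Subsingleton.elim (1 : S.level ⊥) 0]
  have hX : (1 : S.obj X) = 0 := by
    rw [← S.nm_one q, hP, S.nm_zero hq]
  exact subsingleton_of_zero_eq_one hX.symm

/-- In `T[1/x](G/e)` the image of the restriction of `x` is both a unit and nilpotent. The Weyl
action plays no role in this direction. -/
theorem isKilpotent_of_isNilpotent_res {H : Subgroup G} {x : T.level H}
    (hx : IsNilpotent (T.res (quot (bot_le : ⊥ ≤ H)) x)) : T.IsKilpotent x := by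
  apply isZero_of_subsingleton_bot
  have hu := (toLocalization_isUnit T x).map ((localization T x).resHom (quot (bot_le : ⊥ ≤ H)))
  have hn := hx.map ((toLocalization T x).ringHom (orbit ⊥))
  have he : (localization T x).resHom (quot (bot_le : ⊥ ≤ H)) ((toLocalization T x).app _ x) =
      (toLocalization T x).ringHom (orbit ⊥) (T.res (quot (bot_le : ⊥ ≤ H)) x) :=
    ((toLocalization T x).app_res _ x).symm
  rw [he] at hu
  obtain ⟨n, hn⟩ := hn
  have h0 := hu.pow n
  rw [hn] at h0
  exact subsingleton_of_zero_eq_one (isUnit_zero_iff.1 h0)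

theorem isNilpotent_res_of_isKilpotent
    (hT : ∀ (g : G) (a : T.level (⊥ : Subgroup G)), T.weyl g a = a) {H : Subgroup G}
    {x : T.level H} (hx : T.IsKilpotent x) :
    IsNilpotent (T.res (quot (bot_le : ⊥ ≤ H)) x) := by
  set y := T.res (quot (bot_le : ⊥ ≤ H)) x with hy
  -- The test object is the fixed point functor of `T(G/e)[1/y]`: there `x` becomes the constant
  -- function `y`, with inverse the constant function `i`.
  let R := Localization.Away y
  let ψ : Mor T (fixedPoint G R) := toFixedPoint hT (algebraMap _ R)
  have hunit : IsUnit (ψ.app (orbit H) x) := by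
    obtain ⟨i, hi⟩ := (IsLocalization.Away.algebraMap_isUnit (S := R) y).exists_right_inv
    refine IsUnit.of_mul_eq_one (M := invariantFunctions R (orbit H))
      ⟨fun _ => i, fun _ _ => rfl⟩ (Subtype.ext (funext fun z => ?_))
    change (ψ.app (orbit H) x).1 z * i = 1
    rw [toFixedPoint_orbit_apply, ← hy, hi]
  obtain ⟨χ, -, -⟩ := localization_universal T x (fixedPoint G R) ψ hunit
  -- A morphism out of the zero functor preserves `0` and `1`, hence forces `1 = 0` in its target.
  have h10 : (1 : (fixedPoint G R).obj (orbit (⊥ : Subgroup G))) = 0 := by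
    rw [← χ.app_one, ← χ.app_zero]
    exact congrArg _ ((hx (orbit ⊥)).elim _ _)
  have hR : algebraMap _ R (1 : T.level (⊥ : Subgroup G)) = 0 := by
    rw [map_one]
    exact congrFun (congrArg Subtype.val h10) (QuotientGroup.mk 1 : G ⧸ (⊥ : Subgroup G))
  -- Vanishing of `1` in the localization means that some power of `y` annihilates `1`.
  obtain ⟨⟨_, n, rfl⟩, hn⟩ := (IsLocalization.map_eq_zero_iff (Submonoid.powers y) R _).1 hR
  exact ⟨n, by simpa using hn⟩

theorem quot_surjective {H K : Subgroup G} (h : H ≤ K) : Function.Surjective (quot h) := by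
  rintro ⟨a⟩
  exact ⟨(QuotientGroup.mk a : G ⧸ H), rfl⟩

/-- The kernel of a morphism of Tambara functors. -/
def Mor.ker {S : TambaraFunctor.{u, w} G} (φ : Mor T S) : T.TambaraIdeal where
  ideal H := RingHom.ker (φ.ringHom (orbit H))
  res_mem h a ha := by
    have ha' : φ.app _ a = 0 := ha
    change φ.app _ _ = 0
    rw [φ.app_res, ha']
    exact map_zero (S.resHom (quot h))
  tr_mem h a ha := by
    have ha' : φ.app _ a = 0 := ha
    change φ.app _ _ = 0
    rw [φ.app_tr, ha', S.tr_zero]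
  nm_mem h a ha := by
    have ha' : φ.app _ a = 0 := ha
    change φ.app _ _ = 0
    -- Norms preserve zero here because the quotient maps between orbits are surjective.
    rw [φ.app_nm, ha', S.nm_zero (quot_surjective h)]
  conj_mem g H a ha := by
    have ha' : φ.app _ a = 0 := ha
    change φ.app _ _ = 0
    rw [φ.app_tr, ha', S.tr_zero]

theorem mem_ker_toFixedPoint
    (hT : ∀ (g : G) (a : T.level (⊥ : Subgroup G)), T.weyl g a = a) {R : Type w} [CommRing R]
    (φ : T.level (⊥ : Subgroup G) →+* R) {H : Subgroup G} (a : T.level H) :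
    a ∈ (toFixedPoint hT φ).ker.ideal H ↔ φ (T.res (quot (bot_le : ⊥ ≤ H)) a) = 0 := by
  constructor
  · intro h
    rw [← toFixedPoint_orbit_apply hT φ a (QuotientGroup.mk 1 : G ⧸ H)]
    exact congrFun (congrArg Subtype.val h) _
  · intro h
    exact Subtype.ext (funext fun x => (toFixedPoint_orbit_apply hT φ a x).trans h)

end Points

end TambaraFunctor

theorem mainTheorem9 {G : Type u} [Group G] [Finite G] (T : TambaraFunctor.{u, v} G)
    (hT : ∀ (g : G) (a : T.level (⊥ : Subgroup G)), T.weyl g a = a) :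
    ∃ I : T.TambaraIdeal, ∀ H : Subgroup G,
      (I.ideal H : Set (T.level H)) = T.kil H ∧
      T.kil H = {x : T.level H |
        T.res (FinGSet.quot (bot_le : ⊥ ≤ H)) x ∈ nilradical (T.level (⊥ : Subgroup G))} := by
  have hkil : ∀ H : Subgroup G, T.kil H = {x : T.level H |
      T.res (FinGSet.quot (bot_le : ⊥ ≤ H)) x ∈ nilradical (T.level (⊥ : Subgroup G))} :=
    fun H => Set.ext fun x =>
      ⟨fun hx => mem_nilradical.2 (TambaraFunctor.isNilpotent_res_of_isKilpotent hT hx),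
        fun hx => TambaraFunctor.isKilpotent_of_isNilpotent_res (mem_nilradical.1 hx)⟩
  -- Reducing modulo the nilradical realizes the nilpotence condition as a kernel, so closure under
  -- all the operations needs no separate argument.
  refine ⟨(TambaraFunctor.toFixedPoint hT
    (Ideal.Quotient.mk (nilradical (T.level (⊥ : Subgroup G))))).ker,
    fun H => ⟨?_, hkil H⟩⟩
  rw [hkil]
  ext x
  exact (TambaraFunctor.mem_ker_toFixedPoint hT _ x).trans Ideal.Quotient.eq_zero_iff_mem
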